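/- Let $\Gamma$ be a discrete abelian group of arbitrary cardinality. A mean on $\ell^\infty(\Gamma)$ (bounded complex-valued functions) is a linear functional $m:\ell^\infty(\Gamma)\to\mathbb C$ with $m(1_\Gamma)=1$ and $m(f)\ge 0$ whenever $f\ge 0$ pointwise; write $m(A):=m(1_A)$ for $A\subseteq\Gamma$, and $A\subset_m B$ if $m(A\setminus B)=0$. The mean $m$ is invariant if $m(f_\gamma)=m(f)$ for all $f\in\ell^\infty(\Gamma)$ and $\gamma\in\Gamma$, where $f_\gamma(x)=f(x-\gamma)$; an extreme invariant mean is an extreme point of the convex set of invariant means. The upper Banach density of $A\subseteq\Gamma$ is $d^*(A):=\sup\{m(A): m \text{ an invariant mean}\}$. Let $b\Gamma$ be the Bohr compactification of $\Gamma$, that is, the Pontryagin dual of the group of all characters of $\Gamma$ taken with the discrete topology, and regard $\Gamma$ as a subgroup of $b\Gamma$ via $\gamma\mapsto(\chi\mapsto\chi(\gamma))$. A set $U\subseteq\Gamma$ is a Bohr neighborhood if there are $\gamma_0\in\Gamma$ and an open set $V\subseteq b\Gamma$ with $\gamma_0\in V$ and $V\cap\Gamma\subseteq U$. A set $S\subseteq\Gamma$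 is syndetic if $S+F=\Gamma$ for some finite $F\subseteq\Gamma$. A set $C\subseteq\Gamma$ is piecewise Bohr (respectively piecewise syndetic) if there are an invariant mean $m$ and a Bohr neighborhood (respectively a syndetic set) $U$ with $U\subset_m C$. If $A,B\subseteq\Gamma$ satisfy $d^*(A)>0$ and $d^*(B)>0$, then $A+B=\{a+b:a\in A,\ b\in B\}$ is piecewise Bohr, and therefore piecewise syndetic. Furthermore, for every extreme invariant mean $\nu$ on $\ell^\infty(\Gamma)$ with $\nu(A)>0$, there is a Bohr neighborhood $U\subseteq\Gamma$ such that $U\subset_\nu A+B$. -/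

import Mathlib

open scoped Pointwise

noncomputable section

namespace SumsetBohr

variable {Γ : Type*}

/-- The space `ℓ^∞(Γ)` of bounded complex-valued functions on `Γ`, with the supremum norm. -/
abbrev LInfty (Γ : Type*) := lp (fun _ : Γ => ℂ) ⊤

/-- The translate `f_γ`, `f_γ(x) = f(x - γ)`. -/
def translateBy [AddCommGroup Γ] (γ : Γ) (f : LInfty Γ) : LInfty Γ :=
  ⟨fun x => f (x - γ), memℓp_infty ⟨‖f‖, by
    rintro _ ⟨x, rfl⟩
    exact lp.norm_apply_le_norm ENNReal.top_ne_zero f (x - γ)⟩⟩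

/-- The indicator function `1_A` as an element of `ℓ^∞(Γ)`. -/
def indicator (A : Set Γ) : LInfty Γ :=
  ⟨A.indicator (fun _ => (1 : ℂ)), memℓp_infty ⟨1, by
    rintro _ ⟨x, rfl⟩
    exact (norm_indicator_le_norm_self (fun _ : Γ => (1 : ℂ)) x).trans (by simp)⟩⟩

open scoped ComplexOrder in
/-- A mean on `ℓ^∞(Γ)`: a linear functional `m` with `m(1_Γ) = 1` and `m(f) ≥ 0` whenever
`f(x) ≥ 0` for all `x`.  (In the order on `ℂ`, `0 ≤ z` says that `z` is real and nonnegative.) -/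
structure IsMean (m : LInfty Γ →ₗ[ℂ] ℂ) : Prop where
  map_one : m (indicator Set.univ) = 1
  map_nonneg : ∀ f : LInfty Γ, (∀ x, 0 ≤ f x) → 0 ≤ m f

/-- The set of translation-invariant means on `ℓ^∞(Γ)`. -/
def invariantMeans (Γ : Type*) [AddCommGroup Γ] : Set (LInfty Γ →ₗ[ℂ] ℂ) :=
  {m | IsMean m ∧ ∀ (γ : Γ) (f : LInfty Γ), m (translateBy γ f) = m f}

/-- The set of extreme invariant means: extreme points of the set of invariant means. -/
def extremeInvariantMeans (Γ : Type*) [AddCommGroup Γ] : Set (LInfty Γ →ₗ[ℂ] ℂ) :=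
  (invariantMeans Γ).extremePoints ℝ

/-- The value `m(A) = m(1_A)`, which is a real number when `m` is a mean. -/
def measureOf (m : LInfty Γ →ₗ[ℂ] ℂ) (A : Set Γ) : ℝ := (m (indicator A)).re

/-- `A ⊂_m B`: the set `A \ B` is `m`-null. -/
def SubsetMod (m : LInfty Γ →ₗ[ℂ] ℂ) (A B : Set Γ) : Prop := measureOf m (A \ B) = 0

/-- The upper Banach density `d^*(A)`: the supremum of `m(A)` over all invariant means `m`. -/
def upperBanachDensity [AddCommGroup Γ] (A : Set Γ) : ℝ :=
  sSup ((fun m => measureOf m A) '' invariantMeans Γ)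

/-- The group of all characters `Γ → 𝕊¹` of the discrete group `Γ`. It carries the discrete
topology, see below. -/
def DiscreteDual (Γ : Type*) [AddCommGroup Γ] := AddChar Γ Circle

instance [AddCommGroup Γ] : CommGroup (DiscreteDual Γ) :=
  inferInstanceAs (CommGroup (AddChar Γ Circle))

instance [AddCommGroup Γ] : TopologicalSpace (DiscreteDual Γ) := ⊥

instance [AddCommGroup Γ] : DiscreteTopology (DiscreteDual Γ) := ⟨rfl⟩

/-- The Bohr compactification `bΓ`: the Pontryagin dual of the group of characters of `Γ` with
the discrete topology (written multiplicatively). -/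
abbrev BohrCompactification (Γ : Type*) [AddCommGroup Γ] := PontryaginDual (DiscreteDual Γ)

/-- Evaluation of characters at `γ`. -/
def evalHom [AddCommGroup Γ] (γ : Γ) : DiscreteDual Γ →ₜ* Circle where
  toFun χ := DFunLike.coe (F := AddChar Γ Circle) χ γ
  map_one' := AddChar.one_apply γ
  map_mul' χ ψ := AddChar.mul_apply (χ : AddChar Γ Circle) ψ γ
  continuous_toFun := continuous_of_discreteTopology

/-- The canonical embedding `ι : Γ → bΓ`, `ι(γ)(χ) = χ(γ)`. -/
def toBohr [AddCommGroup Γ] (γ : Γ) : BohrCompactification Γ := evalHom γ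

/-- `U` is a Bohr neighborhood of `γ₀`: there is an open `V ⊆ bΓ` with `γ₀ ∈ V` and
`V ∩ Γ ⊆ U`, where `Γ` is identified with its image in `bΓ`. -/
def IsBohrNhdOf [AddCommGroup Γ] (γ₀ : Γ) (U : Set Γ) : Prop :=
  ∃ V : Set (BohrCompactification Γ), IsOpen V ∧ toBohr γ₀ ∈ V ∧ toBohr ⁻¹' V ⊆ U

/-- `U` is a Bohr neighborhood (of some point of `Γ`). -/
def IsBohrNhd [AddCommGroup Γ] (U : Set Γ) : Prop := ∃ γ₀ : Γ, IsBohrNhdOf γ₀ U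

/-- `S` is syndetic: finitely many translates of `S` cover `Γ`. -/
def IsSyndetic [AddCommGroup Γ] (S : Set Γ) : Prop :=
  ∃ F : Set Γ, F.Finite ∧ S + F = Set.univ

/-- `C` is piecewise syndetic: `S ⊂_m C` for some invariant mean `m` and some syndetic `S`. -/
def IsPiecewiseSyndetic [AddCommGroup Γ] (C : Set Γ) : Prop :=
  ∃ m ∈ invariantMeans Γ, ∃ S : Set Γ, IsSyndetic S ∧ SubsetMod m S C

/-- `C` is piecewise Bohr: `U ⊂_m C` for some invariant mean `m` and some Bohr neighborhood `U`. -/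
def IsPiecewiseBohr [AddCommGroup Γ] (C : Set Γ) : Prop :=
  ∃ m ∈ invariantMeans Γ, ∃ U : Set Γ, IsBohrNhd U ∧ SubsetMod m U C

end SumsetBohr

end

/-! Fix an extreme invariant mean ν with ν(A) > 0 and any invariant mean μ with μ(B) > 0. The
function x ↦ ∫ 1_B(b) 1_A(x - b) dμ(b) vanishes off A + B, and for ν it should behave like the
series Σ c_χ χ with c_χ = ν(χ̄ 1_A) μ(χ̄ 1_B). Bessel's inequality makes this series absolutely
convergent, and its constant coefficient δ = ν(A) μ(B) is positive, so its real part is positive on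
a Bohr neighborhood.

Means are only finitely additive, so the expansion is used weakly, paired with a bounded function
(`hasSum_avg_correlation`). In the Hilbert space L²(ν), split 1_A into its projection onto the
closed span of the characters and a remainder. Extremality makes ν ergodic
(`avg_map_translate_mul`), so up to scalars the characters are the only joint eigenvectors of the
translations (`exists_eq_smul_charFun`). The remainder is orthogonal to them all, hence weakly
mixing and invisible to the average over b (`avg_orbit_eq_zero`): averaging rank-one operators along
its orbit gives a compact operator commuting with translations, which would otherwise yield a joint
eigenvector not orthogonal to it. Γ may have any cardinality.

Truncating the series gives the Bohr neighborhood (`exists_isBohrNhd_subsetMod_add`). A suitable ν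
exists by Krein–Milman (`exists_extreme_measureOf_ge`), and Bohr neighborhoods are syndetic by
compactness. -/

noncomputable section

namespace SumsetBohr

/-! ### Means as positive functionals, and Cauchy–Schwarz -/

section Means

variable {Γ : Type*}

open scoped ComplexConjugate ComplexOrder

lemma indicator_univ : indicator (Set.univ : Set Γ) = 1 := by
  ext x; simp [indicator]

@[simp] lemma indicator_apply (A : Set Γ) (x : Γ) :
    indicator A x = A.indicator (fun _ => (1 : ℂ)) x := rfl

lemma star_indicator (A : Set Γ) : star (indicator A) = indicator A := by
  ext x
  by_cases h : x ∈ A <;> simp [h]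

section translate
variable [AddCommGroup Γ]

@[simp] lemma translateBy_apply (γ : Γ) (f : LInfty Γ) (x : Γ) : translateBy γ f x = f (x - γ) :=
  rfl

lemma translateBy_add (γ : Γ) (f g : LInfty Γ) :
    translateBy γ (f + g) = translateBy γ f + translateBy γ g := by ext; simp

lemma translateBy_smul (γ : Γ) (c : ℂ) (f : LInfty Γ) :
    translateBy γ (c • f) = c • translateBy γ f := by ext; simp

lemma translateBy_mul (γ : Γ) (f g : LInfty Γ) :
    translateBy γ (f * g) = translateBy γ f * translateBy γ g := by ext; simp

lemma translateBy_star (γ : Γ) (f : LInfty Γ) :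
    translateBy γ (star f) = star (translateBy γ f) := by ext; simp

lemma translateBy_zero (f : LInfty Γ) : translateBy 0 f = f := by ext; simp

lemma translateBy_translateBy (a b : Γ) (f : LInfty Γ) :
    translateBy a (translateBy b f) = translateBy (a + b) f := by
  ext x; simp [sub_sub]

end translate

namespace IsMean

variable {m : LInfty Γ →ₗ[ℂ] ℂ}

lemma map_one' (hm : IsMean m) : m 1 = 1 := by rw [← indicator_univ, hm.map_one]

lemma mono (hm : IsMean m) {f g : LInfty Γ} (h : ∀ x, f x ≤ g x) : m f ≤ m g := by
  rw [← sub_nonneg, ← map_sub]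
  exact hm.map_nonneg _ fun x => by simpa using h x

/-- A mean is real on real-valued functions. -/
lemma conj_map_of_real (hm : IsMean m) {f : LInfty Γ} (h : star f = f) : conj (m f) = m f := by
  have hf : ∀ x, conj (f x) = f x := fun x => by
    have := congrArg (fun g : LInfty Γ => g x) h
    simpa using this
  -- The function ‖f‖ - f is nonnegative, so its mean is real; the mean of the constant is real too.
  have h1 : 0 ≤ m ((‖f‖ : ℂ) • 1 - f) := hm.map_nonneg _ fun x => by
    obtain ⟨r, hr⟩ := Complex.conj_eq_iff_real.1 (hf x)
    have h2 := lp.norm_apply_le_norm ENNReal.top_ne_zero f x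
    rw [hr, Complex.norm_real] at h2
    have : (((‖f‖ : ℂ) • (1 : LInfty Γ) - f) x) = ((‖f‖ - r : ℝ) : ℂ) := by
      rw [lp.coeFn_sub, lp.coeFn_smul]
      simp [hr]
    rw [this, Complex.zero_le_real, sub_nonneg]
    exact (le_abs_self r).trans h2
  rw [map_sub, map_smul, hm.map_one'] at h1
  have h3 := (Complex.nonneg_iff.1 h1).2
  rw [Complex.conj_eq_iff_im]
  simpa using h3.symm

lemma map_star (hm : IsMean m) (f : LInfty Γ) : m (star f) = conj (m f) := by
  have h1 := hm.conj_map_of_real (f := f + star f) (by simp [add_comm])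
  have h2 := hm.conj_map_of_real (f := Complex.I • (f - star f)) (by
    rw [star_smul, star_sub, star_star, Complex.star_def, Complex.conj_I, neg_smul, ← smul_neg,
      neg_sub])
  simp only [map_add, map_sub, map_smul, smul_eq_mul, map_mul, Complex.conj_I] at h1 h2
  have h3 : conj (m f) - conj (m (star f)) = -(m f - m (star f)) := by
    have := congrArg (fun z => Complex.I * z) h2
    simp only [← mul_assoc, mul_neg, neg_mul, Complex.I_mul_I, one_mul, neg_neg] at this
    rw [this]
  linear_combination (-1 / 2 : ℂ) * (h1 + h3)

end IsMean

/-- The space `ℓ^∞(Γ)`, to be equipped with the inner product `⟨f, g⟩ = m (star f * g)`. -/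
def PreGNS {m : LInfty Γ →ₗ[ℂ] ℂ} (_ : IsMean m) := LInfty Γ

namespace PreGNS

variable {m : LInfty Γ →ₗ[ℂ] ℂ} (hm : IsMean m)

instance : AddCommGroup (PreGNS hm) := inferInstanceAs (AddCommGroup (LInfty Γ))
instance : Module ℂ (PreGNS hm) := inferInstanceAs (Module ℂ (LInfty Γ))

/-- The identity map from `ℓ^∞(Γ)` to the pre-Hilbert space of a mean. -/
def of : LInfty Γ ≃ₗ[ℂ] PreGNS hm := LinearEquiv.refl ℂ _

/-- The positive semidefinite form `⟨f, g⟩ = m (star f * g)`. -/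
abbrev core : PreInnerProductSpace.Core ℂ (PreGNS hm) where
  inner f g := m (star ((of hm).symm f) * (of hm).symm g)
  conj_inner_symm f g := by
    rw [← hm.map_star]
    congr 1
    ext x
    simp [mul_comm]
  re_inner_nonneg f := by
    refine (Complex.nonneg_iff.1 (hm.map_nonneg _ fun x => ?_)).1
    simpa using star_mul_self_nonneg (((of hm).symm f) x)
  add_left f g h := by rw [map_add, star_add, add_mul, map_add]
  smul_left f g c := by rw [map_smul, star_smul, smul_mul_assoc, map_smul]; rfl

instance : SeminormedAddCommGroup (PreGNS hm) :=
  InnerProductSpace.Core.toSeminormedAddCommGroup (c := core hm)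
instance : InnerProductSpace ℂ (PreGNS hm) := InnerProductSpace.ofCore (core hm)

lemma inner_of (f g : LInfty Γ) : inner ℂ (of hm f) (of hm g) = m (star f * g) := rfl

lemma norm_of_sq (f : LInfty Γ) : ((‖of hm f‖ ^ 2 : ℝ) : ℂ) = m (star f * f) := by
  rw [← inner_of hm, inner_self_eq_norm_sq_to_K]; simp

end PreGNS

namespace IsMean

variable {m : LInfty Γ →ₗ[ℂ] ℂ}

/-- Cauchy–Schwarz against the constant 1, a unit vector: m(f) = ⟨1, f⟩. -/
lemma norm_map_le (hm : IsMean m) {f : LInfty Γ} {C : ℝ} (hC : ∀ x, ‖f x‖ ≤ C) : ‖m f‖ ≤ C := by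
  have hC0 : 0 ≤ C := by
    by_contra h
    have : IsEmpty Γ := ⟨fun x => h ((norm_nonneg _).trans (hC x))⟩
    have h1 := hm.map_one'
    rw [show (1 : LInfty Γ) = 0 from by ext x; exact isEmptyElim x, map_zero] at h1
    exact zero_ne_one h1
  have h1 := norm_inner_le_norm (𝕜 := ℂ) (PreGNS.of hm 1) (PreGNS.of hm f)
  have h2 : ‖PreGNS.of hm 1‖ = 1 := by
    have := PreGNS.norm_of_sq hm 1
    rw [star_one, mul_one, hm.map_one'] at this
    have h3 : ‖PreGNS.of hm 1‖ ^ 2 = 1 := by exact_mod_cast this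
    exact (pow_eq_one_iff_of_nonneg (norm_nonneg _) two_ne_zero).1 h3
  have h3 : ‖PreGNS.of hm f‖ ^ 2 ≤ C ^ 2 := by
    have h4 : m (star f * f) ≤ m (((C ^ 2 : ℝ) : ℂ) • 1) := hm.mono fun x => by
      have : (star f * f) x = ((‖f x‖ ^ 2 : ℝ) : ℂ) := by
        simp [Complex.conj_mul']
      rw [this]
      simp only [lp.coeFn_smul, Pi.smul_apply, lp.infty_coeFn_one, Pi.one_apply, smul_eq_mul,
        mul_one, Complex.real_le_real]
      gcongr
      exact hC x
    rw [← PreGNS.norm_of_sq hm, map_smul, hm.map_one', smul_eq_mul, mul_one,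
      Complex.real_le_real] at h4
    exact h4
  rw [PreGNS.inner_of, star_one, one_mul, h2, one_mul] at h1
  exact h1.trans (abs_le_of_sq_le_sq' h3 hC0).2

end IsMean

/-- The mean of a bounded function (and `0` for unbounded functions). -/
def avg (m : LInfty Γ →ₗ[ℂ] ℂ) (φ : Γ → ℂ) : ℂ :=
  open Classical in if h : Memℓp φ ⊤ then m ⟨φ, h⟩ else 0

lemma avg_eq (m : LInfty Γ →ₗ[ℂ] ℂ) {φ : Γ → ℂ} (f : LInfty Γ) (h : ∀ x, f x = φ x) :
    avg m φ = m f := by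
  obtain rfl : ⇑f = φ := funext h
  exact dif_pos f.2

lemma avg_coe (m : LInfty Γ →ₗ[ℂ] ℂ) (f : LInfty Γ) : avg m (fun x => f x) = m f :=
  avg_eq m f fun _ => rfl

lemma exists_coe_eq {φ : Γ → ℂ} (h : Memℓp φ ⊤) : ∃ f : LInfty Γ, φ = fun x => f x :=
  ⟨⟨φ, h⟩, rfl⟩

lemma memℓp_of_le {φ : Γ → ℂ} {C : ℝ} (h : ∀ x, ‖φ x‖ ≤ C) : Memℓp φ ⊤ :=
  memℓp_infty ⟨C, by rintro _ ⟨x, rfl⟩; exact h x⟩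

section avg
variable {m : LInfty Γ →ₗ[ℂ] ℂ} {φ ψ : Γ → ℂ}

lemma avg_add (hφ : Memℓp φ ⊤) (hψ : Memℓp ψ ⊤) :
    avg m (fun x => φ x + ψ x) = avg m φ + avg m ψ := by
  obtain ⟨f, rfl⟩ := exists_coe_eq hφ
  obtain ⟨g, rfl⟩ := exists_coe_eq hψ
  rw [avg_coe, avg_coe, ← map_add]
  exact avg_eq m (f + g) fun x => by simp

lemma avg_const_mul (hφ : Memℓp φ ⊤) (c : ℂ) : avg m (fun x => c * φ x) = c * avg m φ := by
  obtain ⟨f, rfl⟩ := exists_coe_eq hφ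
  rw [avg_coe, ← smul_eq_mul, ← map_smul]
  exact avg_eq m (c • f) fun x => by simp

lemma avg_mul_const (hφ : Memℓp φ ⊤) (c : ℂ) : avg m (fun x => φ x * c) = avg m φ * c := by
  simp_rw [mul_comm _ c, avg_const_mul hφ]

lemma memℓp_sum {ι : Type*} (s : Finset ι) {φ : ι → Γ → ℂ} (hφ : ∀ i ∈ s, Memℓp (φ i) ⊤) :
    Memℓp (fun x => ∑ i ∈ s, φ i x) ⊤ := by
  convert! Memℓp.finsetSum s hφ using 2

lemma avg_zero : avg m (fun _ => 0) = 0 := by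
  rw [avg_eq m 0 fun x => by simp, map_zero]

lemma avg_sum {ι : Type*} (s : Finset ι) {φ : ι → Γ → ℂ} (hφ : ∀ i ∈ s, Memℓp (φ i) ⊤) :
    avg m (fun x => ∑ i ∈ s, φ i x) = ∑ i ∈ s, avg m (φ i) := by
  classical
  induction s using Finset.induction_on with
  | empty => simpa using avg_zero
  | insert a s ha ih =>
    have h := fun i hi => hφ i (Finset.mem_insert_of_mem hi)
    simp only [Finset.sum_insert ha]
    rw [avg_add (hφ a (Finset.mem_insert_self _ _)) (memℓp_sum s h), ih h]

lemma avg_const (hm : IsMean m) (c : ℂ) : avg m (fun _ => c) = c := by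
  rw [avg_eq m (c • 1) fun x => by simp, map_smul, hm.map_one', smul_eq_mul, mul_one]

lemma avg_conj (hm : IsMean m) (hφ : Memℓp φ ⊤) :
    avg m (fun x => conj (φ x)) = conj (avg m φ) := by
  obtain ⟨f, rfl⟩ := exists_coe_eq hφ
  rw [avg_coe, ← hm.map_star]
  exact avg_eq m (star f) fun x => by simp

lemma avg_nonneg (hm : IsMean m) (h : ∀ x, 0 ≤ φ x) : 0 ≤ avg m φ := by
  unfold avg
  split_ifs with hφ
  · exact hm.map_nonneg _ h
  · exact le_rfl

lemma avg_mono (hm : IsMean m) (hφ : Memℓp φ ⊤) (hψ : Memℓp ψ ⊤) (h : ∀ x, φ x ≤ ψ x) :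
    avg m φ ≤ avg m ψ := by
  obtain ⟨f, rfl⟩ := exists_coe_eq hφ
  obtain ⟨g, rfl⟩ := exists_coe_eq hψ
  rw [avg_coe, avg_coe]
  exact hm.mono h

lemma norm_avg_le (hm : IsMean m) {C : ℝ} (h : ∀ x, ‖φ x‖ ≤ C) : ‖avg m φ‖ ≤ C := by
  obtain ⟨f, rfl⟩ := exists_coe_eq (memℓp_of_le h)
  rw [avg_coe]
  exact hm.norm_map_le h

/-- The Cauchy–Schwarz inequality for a mean. -/
lemma norm_avg_mul_sq_le (hm : IsMean m) (hφ : Memℓp φ ⊤) (hψ : Memℓp ψ ⊤) :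
    ‖avg m (fun x => φ x * ψ x)‖ ^ 2 ≤
      (avg m (fun x => conj (φ x) * φ x)).re * (avg m (fun x => conj (ψ x) * ψ x)).re := by
  obtain ⟨f, rfl⟩ := exists_coe_eq hφ
  obtain ⟨g, rfl⟩ := exists_coe_eq hψ
  have h1 := norm_inner_le_norm (𝕜 := ℂ) (PreGNS.of hm (star f)) (PreGNS.of hm g)
  have h2 := congrArg Complex.re (PreGNS.norm_of_sq hm (star f))
  have h3 := congrArg Complex.re (PreGNS.norm_of_sq hm g)
  rw [Complex.ofReal_re] at h2 h3
  rw [PreGNS.inner_of, star_star] at h1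
  rw [avg_eq m (f * g) fun x => by simp, avg_eq m (star (star f) * star f) fun x => by
    simp [mul_comm], avg_eq m (star g * g) fun x => by simp, ← h2, ← h3, ← mul_pow]
  exact pow_le_pow_left₀ (norm_nonneg _) h1 2

lemma avg_translate [AddCommGroup Γ] (hm : m ∈ invariantMeans Γ) (hφ : Memℓp φ ⊤) (c : Γ) :
    avg m (fun x => φ (x - c)) = avg m φ := by
  obtain ⟨f, rfl⟩ := exists_coe_eq hφ
  rw [avg_coe, ← hm.2 c f]
  exact avg_coe m (translateBy c f)

end avg

end Means

end SumsetBohr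

namespace SumsetBohr

/-! ### The Hilbert space L²(m) and its unitary translations -/

section Translations

variable {Γ : Type*}

open scoped ComplexConjugate ComplexOrder InnerProductSpace
open UniformSpace

/-- The Hilbert space `L²(m)` of a mean `m`. -/
abbrev GNS {m : LInfty Γ →ₗ[ℂ] ℂ} (hm : IsMean m) := Completion (PreGNS hm)

namespace GNS

variable {m : LInfty Γ →ₗ[ℂ] ℂ} (hm : IsMean m)

/-- The canonical map `ℓ^∞(Γ) → L²(m)`. -/
def of : LInfty Γ →ₗ[ℂ] GNS hm :=
  (Completion.toComplL (𝕜 := ℂ) (E := PreGNS hm)).toLinearMap ∘ₗ (PreGNS.of hm).toLinearMap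

lemma of_eq_coe (f : LInfty Γ) : of hm f = ((PreGNS.of hm f : PreGNS hm) : GNS hm) := rfl

lemma inner_of (f g : LInfty Γ) : ⟪of hm f, of hm g⟫_ℂ = m (star f * g) := by
  rw [of_eq_coe, of_eq_coe, Completion.inner_coe, PreGNS.inner_of]

lemma denseRange_of : DenseRange (of hm) :=
  Completion.denseRange_coe.comp (PreGNS.of hm).surjective.denseRange
    (Completion.continuous_coe _)

/-- Vectors are determined by their inner products with bounded functions. -/
lemma ext_inner {v w : GNS hm} (h : ∀ g, ⟪of hm g, v⟫_ℂ = ⟪of hm g, w⟫_ℂ) : v = w := by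
  refine ext_inner_left ℂ fun u => ?_
  refine (denseRange_of hm).induction_on (p := fun u => ⟪u, v⟫_ℂ = ⟪u, w⟫_ℂ) u ?_ h
  exact isClosed_eq (by fun_prop) (by fun_prop)

variable [AddCommGroup Γ] {m : LInfty Γ →ₗ[ℂ] ℂ} (hm : m ∈ invariantMeans Γ)

/-- Translation as an isometry of the pre-Hilbert space of an invariant mean. -/
def preTranslate (γ : Γ) : PreGNS hm.1 →ₗᵢ[ℂ] PreGNS hm.1 where
  toFun f := PreGNS.of hm.1 (translateBy γ ((PreGNS.of hm.1).symm f))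
  map_add' f g := by rw [map_add, translateBy_add, map_add]
  map_smul' c f := by rw [map_smul, translateBy_smul, map_smul]; rfl
  norm_map' f := by
    obtain ⟨f, rfl⟩ := (PreGNS.of hm.1).surjective f
    rw [← sq_eq_sq₀ (norm_nonneg _) (norm_nonneg _), ← Complex.ofReal_inj]
    simp only [LinearMap.coe_mk, AddHom.coe_mk, LinearEquiv.symm_apply_apply]
    rw [PreGNS.norm_of_sq, PreGNS.norm_of_sq, ← translateBy_star, ← translateBy_mul, hm.2]

/-- Translation as an operator on `L²(m)`. -/
def translate (γ : Γ) : GNS hm.1 →L[ℂ] GNS hm.1 :=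
  (preTranslate hm γ).toContinuousLinearMap.completion

@[simp] lemma translate_of (γ : Γ) (f : LInfty Γ) :
    translate hm γ (of hm.1 f) = of hm.1 (translateBy γ f) :=
  ContinuousLinearMap.completion_apply_coe _ _

lemma inner_translate (γ : Γ) (v w : GNS hm.1) :
    ⟪translate hm γ v, translate hm γ w⟫_ℂ = ⟪v, w⟫_ℂ := by
  refine (denseRange_of hm.1).induction_on₂
    (p := fun v w => ⟪translate hm γ v, translate hm γ w⟫_ℂ = ⟪v, w⟫_ℂ) ?_ (fun f g => ?_) v w
  · exact isClosed_eq (by fun_prop) (by fun_prop)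
  · rw [translate_of, translate_of, inner_of, inner_of, ← translateBy_star, ← translateBy_mul, hm.2]

lemma translate_zero (v : GNS hm.1) : translate hm 0 v = v := by
  refine (denseRange_of hm.1).induction_on (p := fun v => translate hm 0 v = v) v ?_ fun f => ?_
  · exact isClosed_eq (by fun_prop) (by fun_prop)
  · rw [translate_of, translateBy_zero]

lemma translate_add (a b : Γ) (v : GNS hm.1) :
    translate hm (a + b) v = translate hm a (translate hm b v) := by
  refine (denseRange_of hm.1).induction_on
    (p := fun v => translate hm (a + b) v = translate hm a (translate hm b v)) v ?_ fun f => ?_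
  · exact isClosed_eq (by fun_prop) (by fun_prop)
  · simp [translateBy_translateBy]

end GNS

end Translations

end SumsetBohr

namespace SumsetBohr

/-! ### Trace-class compactness and joint eigenvectors -/

section CompactOperators

open scoped ComplexConjugate ComplexOrder InnerProductSpace

section Operators

variable {H : Type*} [NormedAddCommGroup H] [InnerProductSpace ℂ H]

lemma orthonormal_insert_finset [DecidableEq H] {s : Finset H}
    (hs : Orthonormal ℂ ((↑) : s → H)) {v : H} (hv : ‖v‖ = 1) (hvs : ∀ w ∈ s, ⟪v, w⟫_ℂ = 0) :
    v ∉ s ∧ Orthonormal ℂ ((↑) : ↥(insert v s) → H) := by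
  have hmem : v ∉ s := fun h => by
    have := hvs v h
    rw [inner_self_eq_zero] at this
    simp [this] at hv
  refine ⟨hmem, ⟨fun ⟨w, hw⟩ => ?_, fun ⟨w, hw⟩ ⟨u, hu⟩ hne => ?_⟩⟩
  · rcases Finset.mem_insert.1 hw with rfl | hw
    · exact hv
    · exact hs.1 ⟨w, hw⟩
  · have hne' : w ≠ u := fun h => hne (Subtype.ext h)
    rcases Finset.mem_insert.1 hw with hw' | hw' <;>
      rcases Finset.mem_insert.1 hu with hu' | hu'
    · exact absurd (hw'.trans hu'.symm) hne'
    · change ⟪w, u⟫_ℂ = 0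
      rw [hw', hvs u hu']
    · change ⟪w, u⟫_ℂ = 0
      rw [hu', inner_eq_zero_symm, hvs w hw']
    · exact hs.2 (i := ⟨w, hw'⟩) (j := ⟨u, hu'⟩) fun h => hne' (congrArg Subtype.val h)

/-- A positive operator of finite trace is compact. -/
theorem isCompactOperator_of_trace_le [CompleteSpace H] (T : H →L[ℂ] H) {C : ℝ}
    (htr : ∀ s : Finset H, Orthonormal ℂ ((↑) : s → H) → ∑ v ∈ s, (⟪T v, v⟫_ℂ).re ≤ C)
    (hT : ∀ v, ‖T v‖ ^ 2 ≤ C * (⟪T v, v⟫_ℂ).re) : IsCompactOperator T := by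
  classical
  have hempty : Orthonormal ℂ ((↑) : (∅ : Finset H) → H) :=
    ⟨fun x => absurd x.2 (Finset.notMem_empty _), fun x => absurd x.2 (Finset.notMem_empty _)⟩
  have hC : 0 ≤ C := by simpa using htr ∅ hempty
  have hcl : IsClosed {S : H →L[ℂ] H | IsCompactOperator S} := isClosed_setOfPred_isCompactOperator
  suffices T ∈ closure {S : H →L[ℂ] H | IsCompactOperator S} by rwa [hcl.closure_eq] at this
  rw [Metric.mem_closure_iff]
  intro ε hε
  let S : Set ℝ := {r | ∃ s : Finset H, Orthonormal ℂ ((↑) : s → H) ∧ r = ∑ v ∈ s, (⟪T v, v⟫_ℂ).re}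
  have hSne : S.Nonempty := ⟨_, ∅, hempty, rfl⟩
  have hSb : BddAbove S := ⟨C, by rintro _ ⟨s, hs, rfl⟩; exact htr s hs⟩
  -- Chosen so that C η ≤ (ε/2)²; the + 1 covers C = 0. A system `s` whose partial trace is within η
  -- of the supremum leaves at most η for any further orthogonal unit vector.
  let η : ℝ := (ε / 2) ^ 2 / (C + 1)
  have hη : 0 < η := by positivity
  obtain ⟨_, ⟨s, hs, rfl⟩, hlt⟩ := exists_lt_of_lt_csSup hSne (sub_lt_self (sSup S) hη)
  let W : Submodule ℂ H := Submodule.span ℂ (s : Set H)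
  have : FiniteDimensional ℂ W := FiniteDimensional.span_of_finite ℂ s.finite_toSet
  have hunit : ∀ v ∈ Wᗮ, ‖v‖ = 1 → (⟪T v, v⟫_ℂ).re ≤ η := by
    intro v hv hv1
    obtain ⟨hmem, hon⟩ := orthonormal_insert_finset hs hv1 fun w hw =>
      Submodule.inner_left_of_mem_orthogonal (Submodule.subset_span hw) hv
    have := le_csSup hSb ⟨_, hon, rfl⟩
    rw [Finset.sum_insert hmem] at this
    linarith
  have hperp : ∀ v ∈ Wᗮ, (⟪T v, v⟫_ℂ).re ≤ η * ‖v‖ ^ 2 := by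
    intro v hv
    rcases eq_or_ne v 0 with rfl | hv0
    · simp
    have h := hunit (((‖v‖⁻¹ : ℝ) : ℂ) • v) (Submodule.smul_mem _ _ hv) (by
      rw [norm_smul]; simp [hv0])
    rw [map_smul, inner_smul_left, inner_smul_right, Complex.conj_ofReal, ← mul_assoc,
      ← Complex.ofReal_mul, Complex.re_ofReal_mul] at h
    have hpos : 0 < ‖v‖ := norm_pos_iff.2 hv0
    field_simp at h
    rwa [mul_comm η]
  have hTperp : ∀ v ∈ Wᗮ, ‖T v‖ ≤ ε / 2 * ‖v‖ := by
    intro v hv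
    refine abs_le_of_sq_le_sq' ?_ (by positivity) |>.2
    calc ‖T v‖ ^ 2 ≤ C * (⟪T v, v⟫_ℂ).re := hT v
      _ ≤ C * (η * ‖v‖ ^ 2) := by gcongr; exact hperp v hv
      _ ≤ (C + 1) * (η * ‖v‖ ^ 2) := by gcongr; linarith
      _ = (ε / 2 * ‖v‖) ^ 2 := by simp only [η]; field_simp
  refine ⟨T ∘L W.starProjection, ?_, ?_⟩
  · have : ProperSpace W := FiniteDimensional.proper_rclike ℂ W
    exact (isCompactOperator_of_locallyCompactSpace_rng (T ∘L W.subtypeL)).comp_clm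
      W.orthogonalProjectionOnto
  · rw [dist_eq_norm]
    refine lt_of_le_of_lt (ContinuousLinearMap.opNorm_le_bound _ (by positivity) fun v => ?_)
      (half_lt_self hε)
    have h1 : (T - T ∘L W.starProjection) v = T (v - W.starProjection v) := by simp
    rw [h1]
    refine (hTperp _ (W.sub_starProjection_mem_orthogonal v)).trans ?_
    gcongr
    have := Submodule.starProjection_orthogonal_val (K := W) (u := v)
    rw [← this]
    exact Submodule.norm_starProjection_apply_le _ _

/-- A commuting family of endomorphisms leaving a nonzero finite-dimensional subspace invariant
has a joint eigenvector in it. -/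
theorem exists_joint_eigenvector {V ι : Type*} [AddCommGroup V] [Module ℂ V]
    (U : ι → Module.End ℂ V) (hU : ∀ i j v, U i (U j v) = U j (U i v)) (W : Submodule ℂ V)
    [FiniteDimensional ℂ W] (hW : W ≠ ⊥) (hinv : ∀ i, ∀ v ∈ W, U i v ∈ W) :
    ∃ v ∈ W, v ≠ 0 ∧ ∀ i, ∃ c : ℂ, U i v = c • v := by
  induction hn : Module.finrank ℂ W using Nat.strong_induction_on generalizing W with
  | _ n ih =>
    by_cases hscal : ∀ i, ∃ c : ℂ, ∀ v ∈ W, U i v = c • v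
    · obtain ⟨v, hv, hv0⟩ := W.exists_mem_ne_zero_of_ne_bot hW
      exact ⟨v, hv, hv0, fun i => (hscal i).imp fun c hc => hc v hv⟩
    -- Some U i is not scalar on W, so one of its eigenspaces cuts W down to a smaller nonzero
    -- subspace, invariant by commutativity.
    push Not at hscal
    obtain ⟨i, hi⟩ := hscal
    have : Nontrivial W := Submodule.nontrivial_iff_ne_bot.2 hW
    obtain ⟨c, hc⟩ := Module.End.exists_eigenvalue ((U i).restrict (hinv i))
    obtain ⟨w, hw⟩ := hc.exists_hasEigenvector
    have hw1 : U i w = c • (w : V) := congrArg Subtype.val hw.apply_eq_smul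
    let W' : Submodule ℂ V := W ⊓ Module.End.eigenspace (U i) c
    have hlt : W' < W := by
      refine lt_of_le_of_ne inf_le_left fun h => ?_
      obtain ⟨v, hv, hne⟩ := hi c
      rw [← h] at hv
      exact hne (Module.End.mem_eigenspace_iff.1 hv.2)
    have : FiniteDimensional ℂ W' := Submodule.finiteDimensional_of_le hlt.le
    obtain ⟨v, hv, hv0, h⟩ := ih _ (hn ▸ Submodule.finrank_lt_finrank_of_lt hlt) W'
      (fun h => hw.2 (Subtype.ext ((Submodule.mem_bot ℂ).1
        (h ▸ (⟨w.2, Module.End.mem_eigenspace_iff.2 hw1⟩ : (w : V) ∈ W')))))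
      (fun j v hv => ⟨hinv j v hv.1, Module.End.mem_eigenspace_iff.2 (by
        rw [hU, Module.End.mem_eigenspace_iff.1 hv.2, map_smul])⟩) rfl
    exact ⟨v, hlt.le hv, hv0, h⟩

/-- A nonzero compact self-adjoint operator and a commuting family of operators commuting with it
have a joint eigenvector, with nonzero eigenvalue for the compact operator. -/
theorem exists_joint_eigenvector_of_isCompactOperator [CompleteSpace H] {ι : Type*}
    {T : H →L[ℂ] H} (hTc : IsCompactOperator T) (hTs : IsSelfAdjoint T) (hT0 : T ≠ 0)
    (U : ι → H →L[ℂ] H) (hU : ∀ i j v, U i (U j v) = U j (U i v))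
    (hUT : ∀ i v, U i (T v) = T (U i v)) :
    ∃ v : H, v ≠ 0 ∧ (∃ k : ℂ, k ≠ 0 ∧ T v = k • v) ∧ ∀ i, ∃ c : ℂ, U i v = c • v := by
  have : Nontrivial H := by
    by_contra h
    rw [not_nontrivial_iff_subsingleton] at h
    exact hT0 (by ext x; exact Subsingleton.elim _ _)
  -- Self-adjointness gives spectral radius ‖T‖ ≠ 0; compactness turns this spectral value into an
  -- eigenvalue.
  obtain ⟨k, hk, hkn⟩ := spectrum.exists_nnnorm_eq_spectralRadius T
  rw [T.spectralRadius_eq_nnnorm hTs, ENNReal.coe_inj] at hkn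
  have hk0 : k ≠ 0 := by
    rintro rfl
    exact hT0 (by simpa using hkn.symm)
  have hev := (hTc.hasEigenvalue_iff_mem_spectrum hk0).2 hk
  set E := Module.End.eigenspace (T : Module.End ℂ H) k with hE
  have hmemE : ∀ v, v ∈ E ↔ T v = k • v := fun v => Module.End.mem_eigenspace_iff
  have hfd : FiniteDimensional ℂ E := by
    have hr := hTc.restrict' (f := (T : H →ₗ[ℂ] H)) (V := E) (fun v hv => by
      rw [ContinuousLinearMap.coe_coe, (hmemE v).1 hv]; exact E.smul_mem _ hv)
    refine FiniteDimensional.of_isCompactOperator_id (𝕜 := ℂ) ?_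
    convert! hr.smul k⁻¹ using 1
    ext v
    simp [(hmemE v).1 v.2, hk0]
  obtain ⟨v, hv, hv0, h⟩ := exists_joint_eigenvector (fun i => (U i : Module.End ℂ H)) hU E hev
    (fun i v hv => by
      rw [hmemE] at hv ⊢
      rw [ContinuousLinearMap.coe_coe, ← hUT, hv, map_smul])
  exact ⟨v, hv0, ⟨k, hk0, (hmemE v).1 hv⟩, h⟩

end Operators

end CompactOperators

end SumsetBohr

namespace SumsetBohr

/-! ### Weak mixing off the joint eigenvectors -/

section MatrixCoefficients

open scoped ComplexConjugate ComplexOrder InnerProductSpace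

section WeakMixing

variable {Γ : Type*} {H : Type*} [NormedAddCommGroup H] [InnerProductSpace ℂ H]
  {U : Γ → H →L[ℂ] H} {m : LInfty Γ →ₗ[ℂ] ℂ}

lemma norm_apply_of_inner (hU : ∀ a v w, ⟪U a v, U a w⟫_ℂ = ⟪v, w⟫_ℂ) (a : Γ) (v : H) :
    ‖U a v‖ = ‖v‖ := by
  rw [norm_eq_sqrt_re_inner (𝕜 := ℂ), hU, ← norm_eq_sqrt_re_inner]

lemma norm_inner_orbit_le (hU : ∀ a v w, ⟪U a v, U a w⟫_ℂ = ⟪v, w⟫_ℂ) (x f : H) (b : Γ) :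
    ‖⟪x, U b f⟫_ℂ‖ ≤ ‖x‖ * ‖f‖ :=
  (norm_inner_le_norm _ _).trans_eq (by rw [norm_apply_of_inner hU])

lemma memℓp_inner_orbit (hU : ∀ a v w, ⟪U a v, U a w⟫_ℂ = ⟪v, w⟫_ℂ) (x f : H) :
    Memℓp (fun b => ⟪x, U b f⟫_ℂ) ⊤ :=
  memℓp_of_le (norm_inner_orbit_le hU x f)

lemma memℓp_orbit_inner (hU : ∀ a v w, ⟪U a v, U a w⟫_ℂ = ⟪v, w⟫_ℂ) (x f : H) :
    Memℓp (fun b => ⟪U b f, x⟫_ℂ) ⊤ :=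
  memℓp_of_le fun b => by rw [norm_inner_symm]; exact norm_inner_orbit_le hU x f b

lemma memℓp_orbit_mul (hU : ∀ a v w, ⟪U a v, U a w⟫_ℂ = ⟪v, w⟫_ℂ) (x y f : H) :
    Memℓp (fun b => ⟪x, U b f⟫_ℂ * ⟪U b f, y⟫_ℂ) ⊤ :=
  (memℓp_inner_orbit hU x f).infty_mul (memℓp_orbit_inner hU y f)

lemma avg_orbit_self (hm : IsMean m) (hU : ∀ a v w, ⟪U a v, U a w⟫_ℂ = ⟪v, w⟫_ℂ) (f y : H) :
    (avg m fun b => conj ⟪U b f, y⟫_ℂ * ⟪U b f, y⟫_ℂ).re ≤ (‖y‖ * ‖f‖) ^ 2 := by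
  refine (Complex.re_le_norm _).trans (norm_avg_le hm fun b => ?_)
  rw [norm_mul, RCLike.norm_conj, norm_inner_symm, ← sq]
  gcongr
  exact norm_inner_orbit_le hU y f b

variable [CompleteSpace H]

/-- The averaged rank-one operators `x ↦ ⟨U_b f, x⟩ U_b f` along the orbit of `f`. -/
theorem exists_orbit_operator (hm : IsMean m)
    (hU : ∀ a v w, ⟪U a v, U a w⟫_ℂ = ⟪v, w⟫_ℂ) (f : H) :
    ∃ T : H →L[ℂ] H, ∀ x y, ⟪T x, y⟫_ℂ = avg m fun b => ⟪x, U b f⟫_ℂ * ⟪U b f, y⟫_ℂ := by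
  let B : H →ₗ⋆[ℂ] H →ₗ[ℂ] ℂ := LinearMap.mk₂'ₛₗ (starRingEnd ℂ) (RingHom.id ℂ)
    (fun x y => avg m fun b => ⟪x, U b f⟫_ℂ * ⟪U b f, y⟫_ℂ)
    (fun x x' y => by
      simp only [inner_add_left, add_mul]
      exact avg_add (memℓp_orbit_mul hU _ _ _) (memℓp_orbit_mul hU _ _ _))
    (fun c x y => by
      simp only [inner_smul_left, mul_assoc, smul_eq_mul]
      exact avg_const_mul (memℓp_orbit_mul hU _ _ _) _)
    (fun x y y' => by
      simp only [inner_add_right, mul_add]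
      exact avg_add (memℓp_orbit_mul hU _ _ _) (memℓp_orbit_mul hU _ _ _))
    (fun c x y => by
      simp only [inner_smul_right, mul_left_comm _ c, smul_eq_mul, RingHom.id_apply]
      exact avg_const_mul (memℓp_orbit_mul hU _ _ _) _)
  let B' : H →L⋆[ℂ] H →L[ℂ] ℂ := B.mkContinuous₂ (‖f‖ * ‖f‖) fun x y => by
    refine norm_avg_le hm fun b => ?_
    rw [norm_mul, norm_inner_symm (U b f)]
    calc _ ≤ ‖x‖ * ‖f‖ * (‖y‖ * ‖f‖) := by
          gcongr
          · exact norm_inner_orbit_le hU x f b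
          · exact norm_inner_orbit_le hU y f b
      _ = _ := by ring
  exact ⟨InnerProductSpace.continuousLinearMapOfBilin B', fun x y => by
    rw [InnerProductSpace.continuousLinearMapOfBilin_apply]; rfl⟩

variable [AddCommGroup Γ]

/-- A vector orthogonal to all joint eigenvectors of a unitary representation is weakly mixing. -/
theorem avg_orbit_eq_zero (hm : m ∈ invariantMeans Γ) (hU0 : ∀ v, U 0 v = v)
    (hUadd : ∀ a b v, U (a + b) v = U a (U b v))
    (hU : ∀ a v w, ⟪U a v, U a w⟫_ℂ = ⟪v, w⟫_ℂ) {f : H}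
    (hf : ∀ v : H, v ≠ 0 → (∀ a, ∃ c : ℂ, U a v = c • v) → ⟪f, v⟫_ℂ = 0) (x : H)
    {θ : Γ → ℂ} (hθ : Memℓp θ ⊤) : avg m (fun b => θ b * ⟪x, U b f⟫_ℂ) = 0 := by
  obtain ⟨T, hT⟩ := exists_orbit_operator hm.1 hU f
  have hT' : ∀ x y, ⟪x, T y⟫_ℂ = avg m fun b => ⟪x, U b f⟫_ℂ * ⟪U b f, y⟫_ℂ := fun x y => by
    rw [← inner_conj_symm, hT, ← avg_conj hm.1 (memℓp_orbit_mul hU _ _ _)]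
    simp only [map_mul, inner_conj_symm, mul_comm]
  have hTs : IsSelfAdjoint T := by
    rw [ContinuousLinearMap.isSelfAdjoint_iff_isSymmetric]
    exact fun x y => (hT x y).trans (hT' x y).symm
  have hTself : ∀ x, ⟪T x, x⟫_ℂ = avg m fun b => conj ⟪U b f, x⟫_ℂ * ⟪U b f, x⟫_ℂ := fun x => by
    simp only [hT, inner_conj_symm]
  have hTself' : ∀ x, ⟪T x, x⟫_ℂ = avg m fun b => conj ⟪x, U b f⟫_ℂ * ⟪x, U b f⟫_ℂ := fun x => by
    simp only [hT, inner_conj_symm, mul_comm]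
  -- Cauchy–Schwarz bounds the squared average by avg |θ|² · ⟨Tx, x⟩.
  suffices hT0 : T = 0 by
    have h := norm_avg_mul_sq_le hm.1 hθ (memℓp_inner_orbit hU x f)
    rw [← hTself', hT0] at h
    simpa using h
  by_contra hT0
  -- Cauchy–Schwarz gives ‖Tv‖⁴ ≤ ⟨Tv, v⟩ ‖Tv‖² ‖f‖²; cancel ‖Tv‖².
  have hTn : ∀ v, ‖T v‖ ^ 2 ≤ ‖f‖ ^ 2 * (⟪T v, v⟫_ℂ).re := by
    intro v
    rcases eq_or_ne (T v) 0 with h | h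
    · simp [h]
    have h1 := norm_avg_mul_sq_le hm.1 (memℓp_inner_orbit hU v f) (memℓp_orbit_inner hU (T v) f)
    rw [← hT, ← hTself', inner_self_eq_norm_sq_to_K] at h1
    have h2 : (⟪T v, v⟫_ℂ).re * (avg m fun b => conj ⟪U b f, T v⟫_ℂ * ⟪U b f, T v⟫_ℂ).re ≤
        (⟪T v, v⟫_ℂ).re * (‖T v‖ * ‖f‖) ^ 2 := by
      refine mul_le_mul_of_nonneg_left (avg_orbit_self hm.1 hU f (T v)) ?_
      rw [hTself]
      exact (Complex.nonneg_iff.1 (avg_nonneg hm.1 fun b => by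
        simpa using star_mul_self_nonneg (⟪U b f, v⟫_ℂ))).1
    have h3 := h1.trans h2
    rw [norm_pow, RCLike.norm_ofReal, abs_norm] at h3
    have h4 : 0 < ‖T v‖ ^ 2 := by positivity
    refine le_of_mul_le_mul_left ?_ h4
    calc _ = (‖T v‖ ^ 2) ^ 2 := by ring
      _ ≤ _ := h3
      _ = _ := by ring
  -- Bessel's inequality for each U b f, integrated over b.
  have htr : ∀ s : Finset H, Orthonormal ℂ ((↑) : s → H) →
      ∑ v ∈ s, (⟪T v, v⟫_ℂ).re ≤ ‖f‖ ^ 2 := by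
    intro s hs
    simp only [hTself']
    rw [← Complex.re_sum, ← avg_sum (φ := fun v b => conj ⟪v, U b f⟫_ℂ * ⟪v, U b f⟫_ℂ) s fun v _ =>
      (memℓp_inner_orbit hU v f).star_mem.infty_mul (memℓp_inner_orbit hU v f)]
    refine (Complex.re_le_norm _).trans (norm_avg_le hm.1 fun b => ?_)
    have h1 := hs.sum_inner_products_le (U b f) (s := Finset.univ)
    rw [norm_apply_of_inner hU] at h1
    refine le_trans (le_of_eq ?_) h1
    rw [Finset.sum_coe_sort s fun v => ‖⟪v, U b f⟫_ℂ‖ ^ 2]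
    have : ∑ v ∈ s, conj ⟪v, U b f⟫_ℂ * ⟪v, U b f⟫_ℂ =
        ((∑ v ∈ s, ‖⟪v, U b f⟫_ℂ‖ ^ 2 : ℝ) : ℂ) := by
      push_cast
      exact Finset.sum_congr rfl fun v _ => Complex.conj_mul' _
    rw [this, Complex.norm_real, Real.norm_of_nonneg (by positivity)]
  -- Replacing b by b - c inside the invariant mean.
  have hcomm : ∀ c v, U c (T v) = T (U c v) := by
    intro c v
    refine ext_inner_left ℂ fun w => ?_
    obtain ⟨w, rfl⟩ : ∃ w', U c w' = w := ⟨U (-c) w, by rw [← hUadd, add_neg_cancel, hU0]⟩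
    have h1 : ∀ b, U b f = U c (U (b - c) f) := fun b => by rw [← hUadd, add_sub_cancel]
    rw [hU, hT', hT', ← avg_translate hm (memℓp_orbit_mul hU w v f) c]
    congr 1
    ext b
    rw [h1 b, hU, hU]
  obtain ⟨v, hv0, ⟨k, hk0, hk⟩, hv⟩ := exists_joint_eigenvector_of_isCompactOperator
    (isCompactOperator_of_trace_le T htr hTn) hTs hT0 U
    (fun i j v => by rw [← hUadd, ← hUadd, add_comm]) hcomm
  -- A joint eigenvector orthogonal to f is orthogonal to its whole orbit, so ⟨Tv, v⟩ = 0, against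
  -- Tv = kv with k ≠ 0.
  have h1 : ∀ b, ⟪U b f, v⟫_ℂ = 0 := fun b => by
    obtain ⟨c, hc⟩ := hv (-b)
    rw [← hU (-b), ← hUadd, neg_add_cancel, hU0, hc, inner_smul_right, hf v hv0 hv, mul_zero]
  have h2 := hTself v
  simp only [h1, mul_zero, avg_zero, hk, inner_smul_left] at h2
  simp [hk0, hv0] at h2

end WeakMixing

end MatrixCoefficients

end SumsetBohr

namespace SumsetBohr

/-! ### Extreme invariant means are ergodic -/

section Ergodicity

open scoped ComplexConjugate ComplexOrder InnerProductSpace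

variable {Γ : Type*} {ν μ : LInfty Γ →ₗ[ℂ] ℂ}

/-- Bounded functions are spanned by those with values in `[0, 1]`. -/
lemma linearMap_ext_of_unit {M : Type*} [AddCommGroup M] [Module ℂ M] {L L' : LInfty Γ →ₗ[ℂ] M}
    (h : ∀ f : LInfty Γ, (∀ x, 0 ≤ f x) → (∀ x, f x ≤ 1) → L f = L' f) : L = L' := by
  have hreal : ∀ f : LInfty Γ, star f = f → L f = L' f := by
    intro f hf
    have hf' : ∀ x, conj (f x) = f x := fun x => by
      have := congrArg (fun g : LInfty Γ => g x) hf
      simpa using this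
    set c : ℂ := ((2 * (‖f‖ + 1) : ℝ) : ℂ) with hc
    have hc0 : c ≠ 0 := by
      rw [hc, Complex.ofReal_ne_zero]; positivity
    have h1 : L (c⁻¹ • f + (1 / 2 : ℂ) • 1) = L' (c⁻¹ • f + (1 / 2 : ℂ) • 1) := by
      have key : ∀ x, ∃ r : ℝ, 0 ≤ r ∧ r ≤ 1 ∧ (c⁻¹ • f + (1 / 2 : ℂ) • (1 : LInfty Γ)) x = r := by
        intro x
        obtain ⟨r, hr⟩ := Complex.conj_eq_iff_real.1 (hf' x)
        have h2 := lp.norm_apply_le_norm ENNReal.top_ne_zero f x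
        rw [hr, Complex.norm_real, Real.norm_eq_abs, abs_le] at h2
        refine ⟨(2 * (‖f‖ + 1))⁻¹ * r + 1 / 2, ?_, ?_, ?_⟩
        · field_simp; linarith
        · field_simp; linarith
        · rw [lp.coeFn_add, lp.coeFn_smul, lp.coeFn_smul]
          simp [hr, hc]
      refine h _ (fun x => ?_) fun x => ?_ <;> obtain ⟨r, hr0, hr1, hr⟩ := key x <;> rw [hr]
      · exact Complex.zero_le_real.2 hr0
      · rw [← Complex.ofReal_one]
        exact Complex.real_le_real.2 hr1
    have h2 : L 1 = L' 1 := h 1 (fun x => by simp) fun x => by simp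
    simp only [map_add, map_smul, h2, add_left_inj] at h1
    exact smul_right_injective M (inv_ne_zero hc0) h1
  ext f
  have h1 := hreal (f + star f) (by simp [add_comm])
  have h2 := hreal (Complex.I • (f - star f)) (by
    rw [star_smul, star_sub, star_star, Complex.star_def, Complex.conj_I, neg_smul, ← smul_neg,
      neg_sub])
  rw [map_smul, map_smul] at h2
  have h3 := smul_right_injective M Complex.I_ne_zero h2
  have h4 : f = (1 / 2 : ℂ) • ((f + star f) + (f - star f)) := by
    rw [add_add_sub_cancel, ← two_smul ℂ f, smul_smul]; norm_num
  rw [h4, map_smul, map_smul, map_add L (f + star f), map_add L' (f + star f), h1, h3]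

variable [AddCommGroup Γ]

/-- An invariant functional between `0` and an extreme invariant mean is a multiple of it. -/
lemma eq_smul_of_mem_extremeInvariantMeans (hν : ν ∈ extremeInvariantMeans Γ)
    (L : LInfty Γ →ₗ[ℂ] ℂ) (hinv : ∀ γ f, L (translateBy γ f) = L f)
    (h0 : ∀ f : LInfty Γ, (∀ x, 0 ≤ f x) → 0 ≤ L f)
    (h1 : ∀ f : LInfty Γ, (∀ x, 0 ≤ f x) → L f ≤ ν f) : L = L 1 • ν := by
  have hνi : ν ∈ invariantMeans Γ := hν.1
  have hpos : 0 ≤ L 1 := h0 1 fun x => by simp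
  have hle : L 1 ≤ 1 := (h1 1 fun x => by simp).trans_eq hνi.1.map_one'
  -- With t = L 1, ν is the midpoint of (1 - t)ν + L and (1 + t)ν - L. This avoids normalizing L,
  -- which might vanish.
  have hp : (1 - L 1) • ν + L ∈ invariantMeans Γ := by
    refine ⟨⟨?_, fun f hf => ?_⟩, fun γ f => ?_⟩
    · rw [indicator_univ]; simp [hνi.1.map_one']
    · exact add_nonneg (mul_nonneg (sub_nonneg.2 hle) (hνi.1.map_nonneg f hf)) (h0 f hf)
    · simp [hinv, hνi.2]
  have hq : (1 + L 1) • ν - L ∈ invariantMeans Γ := by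
    refine ⟨⟨?_, fun f hf => ?_⟩, fun γ f => ?_⟩
    · rw [indicator_univ]; simp [hνi.1.map_one']
    · have h2 : 0 ≤ (ν f - L f) + L 1 * ν f :=
        add_nonneg (sub_nonneg.2 (h1 f hf)) (mul_nonneg hpos (hνi.1.map_nonneg f hf))
      simp only [LinearMap.sub_apply, LinearMap.smul_apply, smul_eq_mul]
      convert! h2 using 1
      ring
    · simp [hinv, hνi.2]
  have := (mem_extremePoints.1 hν).2 _ hp _ hq ⟨1 / 2, 1 / 2, by norm_num, by norm_num,
    by norm_num, by
    ext f
    simp only [LinearMap.add_apply, LinearMap.smul_apply, LinearMap.sub_apply, smul_eq_mul,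
      Complex.real_smul]
    push_cast
    ring⟩
  ext f
  have h2 := congrArg (fun m : LInfty Γ →ₗ[ℂ] ℂ => m f) this.1
  simp only [LinearMap.add_apply, LinearMap.smul_apply, smul_eq_mul] at h2 ⊢
  linear_combination h2

lemma norm_map_translate_mul_le (hν : IsMean ν) (f g : LInfty Γ) (b : Γ) :
    ‖ν (translateBy b f * g)‖ ≤ ‖f‖ * ‖g‖ :=
  hν.norm_map_le fun x => by
    simp only [lp.infty_coeFn_mul, Pi.mul_apply, translateBy_apply, norm_mul]
    gcongr
    exacts [lp.norm_apply_le_norm ENNReal.top_ne_zero f _,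
      lp.norm_apply_le_norm ENNReal.top_ne_zero g _]

lemma memℓp_map_translate_mul (hν : IsMean ν) (f g : LInfty Γ) :
    Memℓp (fun b => ν (translateBy b f * g)) ⊤ :=
  memℓp_of_le (norm_map_translate_mul_le hν f g)

/-- The bilinear form `(f, g) ↦ ∫ ν(f_b g) dμ(b)`. -/
def avgForm (μ : LInfty Γ →ₗ[ℂ] ℂ) (hν : IsMean ν) : LInfty Γ →ₗ[ℂ] LInfty Γ →ₗ[ℂ] ℂ :=
  LinearMap.mk₂ ℂ (fun f g => avg μ fun b => ν (translateBy b f * g))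
    (fun f f' g => by
      simp only [translateBy_add, add_mul, map_add]
      exact avg_add (memℓp_map_translate_mul hν _ _) (memℓp_map_translate_mul hν _ _))
    (fun c f g => by
      simp only [translateBy_smul, smul_mul_assoc, map_smul, smul_eq_mul]
      exact avg_const_mul (memℓp_map_translate_mul hν _ _) _)
    (fun f g g' => by
      simp only [mul_add, map_add]
      exact avg_add (memℓp_map_translate_mul hν _ _) (memℓp_map_translate_mul hν _ _))
    (fun c f g => by
      simp only [mul_smul_comm, map_smul, smul_eq_mul]
      exact avg_const_mul (memℓp_map_translate_mul hν _ _) _)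

lemma avgForm_apply (hν : IsMean ν) (f g : LInfty Γ) :
    avgForm μ hν f g = avg μ fun b => ν (translateBy b f * g) := rfl

/-- Extreme invariant means are ergodic. -/
theorem avg_map_translate_mul (hν : ν ∈ extremeInvariantMeans Γ) (hμ : μ ∈ invariantMeans Γ)
    (f g : LInfty Γ) : (avg μ fun b => ν (translateBy b f * g)) = ν f * ν g := by
  have hνi : ν ∈ invariantMeans Γ := hν.1
  rw [← avgForm_apply hνi.1]
  suffices avgForm μ hνi.1 = LinearMap.mk₂ ℂ (fun f g => ν f * ν g)
      (fun _ _ _ => by rw [map_add, add_mul])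
      (fun _ _ _ => by rw [map_smul, smul_mul_assoc])
      (fun _ _ _ => by rw [map_add, mul_add])
      (fun _ _ _ => by rw [map_smul, mul_smul_comm]) by rw [this]; rfl
  -- For 0 ≤ f ≤ 1 the form in g is invariant and lies between 0 and ν, so it is a multiple of ν,
  -- with factor its value ν(f) at g = 1.
  refine linearMap_ext_of_unit fun f hf0 hf1 => ?_
  have hval : avgForm μ hνi.1 f 1 = ν f := by
    simp only [avgForm_apply, mul_one, hνi.2, avg_const hμ.1]
  have hnn : ∀ g : LInfty Γ, (∀ x, 0 ≤ g x) → ∀ b, 0 ≤ ν (translateBy b f * g) := fun g hg b =>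
    hνi.1.map_nonneg _ fun x => by simpa using mul_nonneg (hf0 (x - b)) (hg x)
  have := eq_smul_of_mem_extremeInvariantMeans hν (avgForm μ hνi.1 f) (fun γ g => ?_)
    (fun g hg => ?_) (fun g hg => ?_)
  · rw [this, hval]; rfl
  · rw [avgForm_apply, avgForm_apply, ← avg_translate hμ (memℓp_map_translate_mul hνi.1 f g) γ]
    congr 1
    ext b
    rw [← hνi.2 γ (translateBy (b - γ) f * g), translateBy_mul, translateBy_translateBy,
      add_sub_cancel]
  · exact avg_nonneg hμ.1 (hnn g hg)
  · rw [avgForm_apply, ← avg_const hμ.1 (ν g)]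
    refine avg_mono hμ.1 (memℓp_map_translate_mul hνi.1 f g)
      (memℓp_of_le (C := ‖ν g‖) fun _ => le_rfl) fun b => hνi.1.mono fun x => ?_
    simpa using mul_le_mul_of_nonneg_right (hf1 (x - b)) (hg x)

end Ergodicity

end SumsetBohr

namespace SumsetBohr

/-! ### Characters in L²(ν) and the Fourier expansion -/

section Fourier

open scoped ComplexConjugate ComplexOrder InnerProductSpace

section

variable {Γ : Type*} {H : Type*} [NormedAddCommGroup H] [InnerProductSpace ℂ H]
  {U : Γ → H →L[ℂ] H} {m : LInfty Γ →ₗ[ℂ] ℂ}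

lemma memℓp_mul_inner_orbit (hU : ∀ a v w, ⟪U a v, U a w⟫_ℂ = ⟪v, w⟫_ℂ) (θ : LInfty Γ) (x v : H) :
    Memℓp (fun b => θ b * ⟪x, U b v⟫_ℂ) ⊤ :=
  (lp.memℓp θ).infty_mul (memℓp_inner_orbit hU x v)

/-- The weighted average of matrix coefficients is a bounded functional of the vector. -/
lemma exists_avg_functional (hm : IsMean m) (hU : ∀ a v w, ⟪U a v, U a w⟫_ℂ = ⟪v, w⟫_ℂ)
    (θ : LInfty Γ) (x : H) : ∃ L : H →L[ℂ] ℂ, ∀ v, L v = avg m fun b => θ b * ⟪x, U b v⟫_ℂ := by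
  let L : H →ₗ[ℂ] ℂ :=
    { toFun := fun v => avg m fun b => θ b * ⟪x, U b v⟫_ℂ
      map_add' := fun v w => by
        simp only [map_add, inner_add_right, mul_add]
        exact avg_add (memℓp_mul_inner_orbit hU _ _ _) (memℓp_mul_inner_orbit hU _ _ _)
      map_smul' := fun c v => by
        simp only [map_smul, inner_smul_right, mul_left_comm _ c]
        exact avg_const_mul (memℓp_mul_inner_orbit hU _ _ _) _ }
  refine ⟨L.mkContinuous (‖θ‖ * ‖x‖) fun v => norm_avg_le hm fun b => ?_, fun v => rfl⟩
  rw [norm_mul, mul_assoc]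
  gcongr
  exacts [lp.norm_apply_le_norm ENNReal.top_ne_zero θ b, norm_inner_orbit_le hU x v b]

end

variable {Γ : Type*} [AddCommGroup Γ] {m ν μ : LInfty Γ →ₗ[ℂ] ℂ}

/-- A character of `Γ`, as a bounded function. -/
def charFun (χ : AddChar Γ Circle) : LInfty Γ :=
  ⟨fun x => (χ x : ℂ), memℓp_of_le (C := 1) fun _ => (Circle.norm_coe _).le⟩

@[simp] lemma charFun_apply (χ : AddChar Γ Circle) (x : Γ) : charFun χ x = (χ x : ℂ) := rfl

lemma charFun_one : charFun (1 : AddChar Γ Circle) = 1 := by ext x; simp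

lemma circle_conj_mul (z : Circle) : conj (z : ℂ) * z = 1 := by
  rw [← Circle.coe_inv_eq_conj, ← Circle.coe_mul, inv_mul_cancel, Circle.coe_one]

lemma star_charFun_mul_self (χ : AddChar Γ Circle) : star (charFun χ) * charFun χ = 1 := by
  ext x
  simpa using circle_conj_mul (χ x)

lemma translateBy_charFun (χ : AddChar Γ Circle) (b : Γ) :
    translateBy b (charFun χ) = conj (χ b : ℂ) • charFun χ := by
  ext x
  simp [AddChar.map_sub_eq_div, div_eq_mul_inv, mul_comm, ← Circle.coe_inv_eq_conj]

/-- Translation by b multiplies χ̄ψ by a scalar that is not 1 once χ(b) ≠ ψ(b). -/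
lemma map_star_charFun_mul (hm : m ∈ invariantMeans Γ) {χ ψ : AddChar Γ Circle} (h : χ ≠ ψ) :
    m (star (charFun χ) * charFun ψ) = 0 := by
  obtain ⟨b, hb⟩ := DFunLike.ne_iff.1 h
  have h1 := hm.2 b (star (charFun χ) * charFun ψ)
  rw [translateBy_mul, translateBy_star, translateBy_charFun, translateBy_charFun, star_smul,
    smul_mul_smul_comm, map_smul, smul_eq_mul] at h1
  by_contra h0
  have h2 := mul_right_cancel₀ h0 (h1.trans (one_mul _).symm)
  apply hb
  rw [Complex.star_def, Complex.conj_conj] at h2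
  have h3 : (χ b : ℂ) = ψ b := by
    linear_combination (ψ b : ℂ) * h2 - (χ b : ℂ) * circle_conj_mul (ψ b)
  exact Circle.ext h3

/-- Characters are orthonormal in `L²(m)` for each invariant mean `m`. -/
lemma orthonormal_charFun (hm : m ∈ invariantMeans Γ) :
    Orthonormal ℂ fun χ : AddChar Γ Circle => GNS.of hm.1 (charFun χ) := by
  classical
  rw [orthonormal_iff_ite]
  intro χ ψ
  rw [GNS.inner_of]
  split_ifs with h
  · rw [h, star_charFun_mul_self, hm.1.map_one']
  · exact map_star_charFun_mul hm h

lemma translate_of_charFun (hm : m ∈ invariantMeans Γ) (χ : AddChar Γ Circle) (b : Γ) :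
    GNS.translate hm b (GNS.of hm.1 (charFun χ)) = conj (χ b : ℂ) • GNS.of hm.1 (charFun χ) := by
  rw [GNS.translate_of, translateBy_charFun, map_smul]

/-- Averaging χ(b) times translation by b is, weakly, the projection onto the line of χ. For bounded
f, χ(b) f_b = χ (χ̄ f)_b, so ergodicity applies to χ̄ f and ḡ χ; density does the rest. -/
lemma avg_char_mul_inner (he : ν ∈ extremeInvariantMeans Γ) (hν : ν ∈ invariantMeans Γ)
    (hμ : μ ∈ invariantMeans Γ)
    (χ : AddChar Γ Circle) (g : LInfty Γ) (v : GNS hν.1) :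
    (avg μ fun b => charFun χ b * ⟪GNS.of hν.1 g, GNS.translate hν b v⟫_ℂ) =
      ⟪GNS.of hν.1 g, GNS.of hν.1 (charFun χ)⟫_ℂ *
        ⟪GNS.of hν.1 (charFun χ), v⟫_ℂ := by
  obtain ⟨L, hL⟩ := exists_avg_functional hμ.1 (GNS.inner_translate hν) (charFun χ)
    (GNS.of hν.1 g)
  rw [← hL]
  refine (GNS.denseRange_of hν.1).induction_on (p := fun v => L v =
      ⟪GNS.of hν.1 g, GNS.of hν.1 (charFun χ)⟫_ℂ *
        ⟪GNS.of hν.1 (charFun χ), v⟫_ℂ) v (isClosed_eq (by fun_prop) (by fun_prop)) fun f => ?_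
  rw [hL, GNS.inner_of, GNS.inner_of, mul_comm, ← avg_map_translate_mul he hμ]
  congr 1
  ext b
  rw [GNS.translate_of, GNS.inner_of, ← smul_eq_mul, ← map_smul, translateBy_mul,
    translateBy_star, translateBy_charFun, star_smul, Complex.star_def, Complex.conj_conj]
  congr 1
  ext x
  simp only [lp.coeFn_smul, lp.infty_coeFn_mul, Pi.smul_apply, Pi.mul_apply, smul_eq_mul,
    charFun_apply, lp.coeFn_star, Pi.star_apply, Complex.star_def, translateBy_apply]
  linear_combination (-(χ b : ℂ) * conj (g x) * f (x - b)) * circle_conj_mul (χ x)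

/-- For an extreme invariant mean, joint eigenvectors are multiples of characters. -/
theorem exists_eq_smul_charFun (he : ν ∈ extremeInvariantMeans Γ) (hν : ν ∈ invariantMeans Γ)
    {v : GNS hν.1} (hv0 : v ≠ 0)
    (hv : ∀ a, ∃ c : ℂ, GNS.translate hν a v = c • v) :
    ∃ (χ : AddChar Γ Circle) (k : ℂ), v = k • GNS.of hν.1 (charFun χ) := by
  choose c hc using hv
  have hnorm : ∀ a, ‖c a‖ = 1 := fun a => by
    have h := norm_apply_of_inner (GNS.inner_translate hν) a v
    rw [hc, norm_smul] at h
    exact mul_right_cancel₀ (norm_ne_zero_iff.2 hv0) (h.trans (one_mul _).symm)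
  have hinj := smul_left_injective ℂ hv0
  have hc0 : c 0 = 1 := hinj (by simp only [← hc, GNS.translate_zero, one_smul])
  have hcadd : ∀ a b, c (a + b) = c a * c b := fun a b => hinj (by
    simp only [← hc, GNS.translate_add]
    rw [hc b, map_smul, hc a, smul_smul, mul_comm])
  let z : Γ → Circle := fun a => ⟨c a, mem_sphere_zero_iff_norm.2 (hnorm a)⟩
  let χ : AddChar Γ Circle :=
    -- Inverted because translation by a acts on χ by conj χ(a).
    { toFun := fun a => (z a)⁻¹
      map_zero_eq_one' := by
        rw [inv_eq_one]; exact Circle.ext hc0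
      map_add_eq_mul' := fun a b => by
        rw [← mul_inv]; exact congrArg _ (Circle.ext (hcadd a b)) }
  have hχ : ∀ a, (χ a : ℂ) * c a = 1 := fun a => by
    have : (((z a)⁻¹ * z a : Circle) : ℂ) = 1 := by rw [inv_mul_cancel, Circle.coe_one]
    rwa [Circle.coe_mul] at this
  refine ⟨χ, ⟪GNS.of hν.1 (charFun χ), v⟫_ℂ, GNS.ext_inner _ fun g => ?_⟩
  rw [inner_smul_right, mul_comm, ← avg_char_mul_inner he hν hν χ g v]
  simp only [hc, inner_smul_right, charFun_apply, ← mul_assoc, hχ, one_mul]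
  rw [avg_const hν.1]

/-- The Fourier expansion of averaged correlations. -/
theorem hasSum_avg_correlation (he : ν ∈ extremeInvariantMeans Γ) (hν : ν ∈ invariantMeans Γ)
    (hμ : μ ∈ invariantMeans Γ)
    (f g θ : LInfty Γ) :
    HasSum (fun χ : AddChar Γ Circle => ν (star (charFun χ) * f) *
        (μ (star (charFun χ) * θ) * ν (star g * charFun χ)))
      (avg μ fun b => θ b * ν (star g * translateBy b f)) := by
  set ξ : AddChar Γ Circle → GNS hν.1 := fun χ => GNS.of hν.1 (charFun χ) with hξ
  have hon : Orthonormal ℂ ξ := orthonormal_charFun hν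
  set F := GNS.of hν.1 f with hF
  have hsum : Summable fun χ => ⟪ξ χ, F⟫_ℂ • ξ χ := by
    have := (hon.orthogonalFamily.summable_iff_norm_sq_summable fun χ => ⟪ξ χ, F⟫_ℂ).2
      (hon.inner_products_summable F)
    simpa using this
  obtain ⟨F₁, hF₁⟩ := hsum
  have horth : ∀ χ, ⟪F - F₁, ξ χ⟫_ℂ = 0 := fun χ => by
    rw [inner_eq_zero_symm, inner_sub_right, sub_eq_zero]
    have h1 := hF₁.mapL (innerSL ℂ (ξ χ))
    have h2 := hasSum_single (f := fun ψ => innerSL ℂ (ξ χ) (⟪ξ ψ, F⟫_ℂ • ξ ψ)) χ fun ψ hψ => by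
      simp [hon.2 hψ.symm]
    rw [innerSL_apply_apply] at h1
    rw [h1.unique h2, innerSL_apply_apply, inner_smul_right, inner_self_eq_norm_sq_to_K, hon.1]
    simp
  obtain ⟨L, hL⟩ := exists_avg_functional hμ.1 (GNS.inner_translate hν) θ (GNS.of hν.1 g)
  -- F₁ is the projection onto the closed span of the characters; the remainder is weakly mixing.
  have hL0 : L (F - F₁) = 0 := by
    rw [hL]
    refine avg_orbit_eq_zero hμ (GNS.translate_zero hν) (GNS.translate_add hν)
      (GNS.inner_translate hν) (fun v hv0 hv => ?_) _ (lp.memℓp θ)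
    obtain ⟨χ, k, rfl⟩ := exists_eq_smul_charFun he hν hv0 hv
    rw [inner_smul_right, horth, mul_zero]
  rw [map_sub, sub_eq_zero] at hL0
  convert! hF₁.mapL L using 1
  · ext χ
    rw [map_smul, smul_eq_mul, GNS.inner_of, hL]
    simp only [hξ, translate_of_charFun, inner_smul_right, GNS.inner_of, ← mul_assoc]
    rw [avg_mul_const (φ := fun b => θ b * conj (χ b : ℂ))
      ((lp.memℓp θ).infty_mul (lp.memℓp (star (charFun χ)))), mul_assoc]
    congr 2
    exact (avg_eq μ _ fun b => by simp [mul_comm]).symm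
  · rw [← hL0, hL]
    simp only [hF, GNS.translate_of, GNS.inner_of]

end Fourier

end SumsetBohr

namespace SumsetBohr

/-! ### Bohr neighborhoods, extreme means, and the sumset -/

section BohrSets

open scoped ComplexConjugate ComplexOrder InnerProductSpace
open Filter Topology

namespace IsMean

variable {Γ : Type*} {m : LInfty Γ →ₗ[ℂ] ℂ}

lemma re_map_mono (hm : IsMean m) {f g : LInfty Γ} (h : ∀ x, (f x).re ≤ (g x).re) :
    (m f).re ≤ (m g).re := by
  have h1 : 0 ≤ m ((g - f) + star (g - f)) := hm.map_nonneg _ fun x => by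
    have : ((g - f) + star (g - f) : LInfty Γ) x = ((2 * ((g x).re - (f x).re) : ℝ) : ℂ) := by
      rw [lp.coeFn_add, Pi.add_apply, lp.coeFn_star, Pi.star_apply, Complex.star_def,
        Complex.add_conj]
      simp
    rw [this, Complex.zero_le_real]
    linarith [h x]
  rw [map_add, hm.map_star, Complex.add_conj, Complex.zero_le_real, map_sub, Complex.sub_re] at h1
  linarith

lemma norm_map_le_re (hm : IsMean m) {f g : LInfty Γ} (h : ∀ x, ‖f x‖ ≤ (g x).re) :
    ‖m f‖ ≤ (m g).re := by
  rcases eq_or_ne (m f) 0 with h0 | h0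
  · rw [h0, norm_zero]
    have := hm.re_map_mono (f := 0) (g := g) fun x => by
      simpa using (norm_nonneg _).trans (h x)
    simpa using this
  have hn : (‖m f‖ : ℂ) ≠ 0 := by simpa using h0
  -- A unimodular rotation making m(c f) = |m(f)|, so that real parts can be compared.
  set c : ℂ := conj (m f) / ‖m f‖ with hc
  have hcn : ‖c‖ = 1 := by simp [hc, h0]
  have hcm : m (c • f) = ‖m f‖ := by
    rw [map_smul, smul_eq_mul, hc, div_mul_eq_mul_div, Complex.conj_mul', sq,
      mul_div_cancel_right₀ _ hn]
  have := hm.re_map_mono (f := c • f) (g := g) fun x => by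
    refine (Complex.re_le_norm _).trans ?_
    rw [lp.coeFn_smul, Pi.smul_apply, norm_smul, hcn, one_mul]
    exact h x
  rwa [hcm, Complex.ofReal_re] at this

lemma coe_measureOf (hm : IsMean m) (A : Set Γ) : (measureOf m A : ℂ) = m (indicator A) :=
  Complex.conj_eq_iff_re.1 (hm.conj_map_of_real (star_indicator A))

lemma measureOf_nonneg (hm : IsMean m) (A : Set Γ) : 0 ≤ measureOf m A := by
  rw [← Complex.zero_le_real, hm.coe_measureOf]
  refine hm.map_nonneg _ fun x => ?_
  by_cases h : x ∈ A <;> simp [h]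

end IsMean

variable {Γ : Type*} [AddCommGroup Γ] {ν μ : LInfty Γ →ₗ[ℂ] ℂ}

lemma toBohr_add (a b : Γ) : toBohr (a + b) = toBohr a * toBohr b :=
  PontryaginDual.ext fun χ => AddChar.map_add_eq_mul (χ : AddChar Γ Circle) a b

/-- A superlevel set of the real part of a trigonometric polynomial is a Bohr neighborhood of each
of its points. -/
lemma isBohrNhdOf_trigPolynomial (F : Finset (AddChar Γ Circle)) (c : AddChar Γ Circle → ℂ) (t : ℝ)
    {γ₀ : Γ} (h : t < (∑ χ ∈ F, c χ * (χ γ₀ : ℂ)).re) :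
    IsBohrNhdOf γ₀ {x | t < (∑ χ ∈ F, c χ * (χ x : ℂ)).re} := by
  refine ⟨{z | t < (∑ χ ∈ F, c χ * ((show DiscreteDual Γ →ₜ* Circle from z) χ : ℂ)).re}, ?_, h,
    fun x hx => hx⟩
  refine isOpen_lt continuous_const (Complex.continuous_re.comp
    (continuous_finsetSum _ fun χ _ => continuous_const.mul (continuous_subtype_val.comp ?_)))
  exact continuous_eval_const (F := DiscreteDual Γ →ₜ* Circle) χ

/-- Preimages of open sets under homomorphisms to compact groups are empty or syndetic. -/
lemma isSyndetic_preimage {G : Type*} [CommGroup G] [TopologicalSpace G] [IsTopologicalGroup G]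
    [CompactSpace G] {φ : Γ → G} (hφ : ∀ a b, φ (a + b) = φ a * φ b) {V : Set G} (hV : IsOpen V)
    {γ₀ : Γ} (hγ₀ : φ γ₀ ∈ V) : IsSyndetic (φ ⁻¹' V) := by
  have hsub : ∀ a b, φ (a - b) = φ a * (φ b)⁻¹ := fun a b => by
    rw [eq_mul_inv_iff_mul_eq, ← hφ, sub_add_cancel]
  -- Covering only the closure of the image makes density of φ unnecessary.
  have hK : IsCompact (closure (Set.range φ)) := isClosed_closure.isCompact
  obtain ⟨t, ht⟩ := hK.elim_finite_subcover (fun γ : Γ => (fun z => z * (φ γ)⁻¹) ⁻¹' V)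
    (fun γ => hV.preimage (by fun_prop)) (fun z hz => by
      have hO : IsOpen ((fun y => z * (y * (φ γ₀)⁻¹)⁻¹) ⁻¹' V) := hV.preimage (by fun_prop)
      obtain ⟨_, hy, γ, rfl⟩ := mem_closure_iff.1 hz _ hO (by simpa using hγ₀)
      refine Set.mem_iUnion.2 ⟨γ - γ₀, ?_⟩
      simpa only [Set.mem_preimage, hsub] using hy)
  refine ⟨t, t.finite_toSet, Set.eq_univ_of_forall fun x => ?_⟩
  obtain ⟨γ, hγ, hx⟩ := Set.mem_iUnion₂.1 (ht (subset_closure ⟨x, rfl⟩))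
  exact ⟨x - γ, by simpa only [Set.mem_preimage, hsub] using hx, γ, hγ, sub_add_cancel x γ⟩

lemma IsBohrNhd.isSyndetic {U : Set Γ} (hU : IsBohrNhd U) : IsSyndetic U := by
  obtain ⟨γ₀, V, hV, hγ₀, hVU⟩ := hU
  obtain ⟨t, ht, h⟩ := isSyndetic_preimage toBohr_add hV hγ₀
  exact ⟨t, ht, Set.eq_univ_of_univ_subset (h ▸ Set.add_subset_add_right hVU)⟩

/-- Each value `m(A)` of an invariant mean is dominated by that of an extreme invariant mean. -/
theorem exists_extreme_measureOf_ge {m : LInfty Γ →ₗ[ℂ] ℂ} (hm : m ∈ invariantMeans Γ)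
    (A : Set Γ) : ∃ ν ∈ extremeInvariantMeans Γ, measureOf m A ≤ measureOf ν A := by
  let K : Set (LInfty Γ → ℂ) := (fun m : LInfty Γ →ₗ[ℂ] ℂ => (m : LInfty Γ → ℂ)) '' invariantMeans Γ
  have hKeq : K = {φ | (∀ f g, φ (f + g) = φ f + φ g) ∧ (∀ (c : ℂ) f, φ (c • f) = c * φ f) ∧
      φ (indicator Set.univ) = 1 ∧ (∀ f : LInfty Γ, (∀ x, 0 ≤ f x) → 0 ≤ φ f) ∧
      ∀ (γ : Γ) f, φ (translateBy γ f) = φ f} := by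
    ext φ
    constructor
    · rintro ⟨m, hm, rfl⟩
      exact ⟨map_add m, map_smul m, hm.1.map_one, hm.1.map_nonneg, hm.2⟩
    · rintro ⟨h1, h2, h3, h4, h5⟩
      exact ⟨⟨⟨φ, h1⟩, h2⟩, ⟨⟨h3, h4⟩, h5⟩, rfl⟩
  have hKcl : IsClosed K := by
    rw [hKeq]
    simp only [Set.ofPred_and, Set.ofPred_forall]
    refine .inter ?_ (.inter ?_ (.inter ?_ (.inter ?_ ?_)))
    · exact isClosed_iInter fun f => isClosed_iInter fun g =>
        isClosed_eq (continuous_apply _) ((continuous_apply f).add (continuous_apply g))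
    · exact isClosed_iInter fun c => isClosed_iInter fun f =>
        isClosed_eq (continuous_apply _) (continuous_const.mul (continuous_apply _))
    · exact isClosed_eq (continuous_apply _) continuous_const
    · exact isClosed_iInter fun f => isClosed_iInter fun hf =>
        isClosed_le continuous_const (continuous_apply _)
    · exact isClosed_iInter fun c => isClosed_iInter fun f =>
        isClosed_eq (continuous_apply _) (continuous_apply _)
  have hKc : IsCompact K := by
    refine (isCompact_univ_pi fun f : LInfty Γ =>
      isCompact_closedBall (0 : ℂ) ‖f‖).of_isClosed_subset hKcl ?_
    rintro _ ⟨m, hm, rfl⟩ f -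
    rw [mem_closedBall_zero_iff]
    exact hm.1.norm_map_le fun x => lp.norm_apply_le_norm ENNReal.top_ne_zero f x
  let l : StrongDual ℝ (LInfty Γ → ℂ) :=
    Complex.reCLM ∘L ContinuousLinearMap.proj (R := ℝ) (indicator A)
  have hl : ∀ φ, l φ = (φ (indicator A)).re := fun φ => rfl
  -- The maximizers of m(A) form a nonempty compact face of the weak-* compact set K; an extreme
  -- point of this face is extreme in K.
  have hexp : IsExposed ℝ K (l.toExposed K) := ContinuousLinearMap.toExposed.isExposed
  obtain ⟨φ₀, hφ₀, hmax⟩ := hKc.exists_isMaxOn ⟨_, m, hm, rfl⟩ l.continuous.continuousOn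
  obtain ⟨φ, hφ⟩ := (hexp.isCompact hKc).extremePoints_nonempty ⟨φ₀, hφ₀, hmax⟩
  have hφK := hexp.isExtreme.extremePoints_subset_extremePoints hφ
  obtain ⟨ν, hν, rfl⟩ := hφK.1
  refine ⟨ν, mem_extremePoints.2 ⟨hν, fun m₁ h₁ m₂ h₂ hseg => ?_⟩, hφ.1.2 _ ⟨m, hm, rfl⟩⟩
  obtain ⟨a, b, ha, hb, hab, rfl⟩ := hseg
  have := (mem_extremePoints.1 hφK).2 _ ⟨m₁, h₁, rfl⟩ _ ⟨m₂, h₂, rfl⟩ ⟨a, b, ha, hb, hab, rfl⟩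
  exact ⟨DFunLike.coe_injective this.1, DFunLike.coe_injective this.2⟩

/-- The supremum of nonpositive reals is nonpositive, also for the empty set, where `sSup` is 0; so
existence of invariant means is not needed separately. -/
lemma exists_measureOf_pos {A : Set Γ} (hA : 0 < upperBanachDensity A) :
    ∃ m ∈ invariantMeans Γ, 0 < measureOf m A := by
  by_contra! h
  refine hA.not_ge (Real.sSup_nonpos ?_)
  rintro _ ⟨m, hm, rfl⟩
  exact h m hm

/-- The summability of products of Fourier coefficients of bounded functions. -/
lemma summable_fourier_mul (hν : ν ∈ invariantMeans Γ) (hμ : μ ∈ invariantMeans Γ)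
    (f g : LInfty Γ) : Summable fun χ : AddChar Γ Circle =>
      ‖ν (star (charFun χ) * f) * μ (star (charFun χ) * g)‖ := by
  have h1 := (orthonormal_charFun hν).inner_products_summable (GNS.of hν.1 f)
  have h2 := (orthonormal_charFun hμ).inner_products_summable (GNS.of hμ.1 g)
  simp only [GNS.inner_of] at h1 h2
  refine Summable.of_nonneg_of_le (fun _ => norm_nonneg _) (fun χ => ?_) (h1.add h2)
  rw [norm_mul]
  nlinarith [sq_nonneg (‖ν (star (charFun χ) * f)‖ - ‖μ (star (charFun χ) * g)‖),
    sq_nonneg (‖ν (star (charFun χ) * f)‖ + ‖μ (star (charFun χ) * g)‖)]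

/-- Only ν must be extreme; μ is any invariant mean charging B, unrelated to ν. -/
theorem exists_isBohrNhd_subsetMod_add (he : ν ∈ extremeInvariantMeans Γ)
    (hμ : μ ∈ invariantMeans Γ) {A B : Set Γ} (hA : 0 < measureOf ν A) (hB : 0 < measureOf μ B) :
    ∃ U : Set Γ, IsBohrNhd U ∧ SubsetMod ν U (A + B) := by
  classical
  have hν : ν ∈ invariantMeans Γ := he.1
  set c : AddChar Γ Circle → ℂ := fun χ =>
    ν (star (charFun χ) * indicator A) * μ (star (charFun χ) * indicator B) with hc
  set δ : ℝ := measureOf ν A * measureOf μ B with hδ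
  have hδ0 : 0 < δ := mul_pos hA hB
  have hc1 : c 1 = δ := by
    simp only [hc, charFun_one, star_one, one_mul]
    rw [hδ, Complex.ofReal_mul, hν.1.coe_measureOf, hμ.1.coe_measureOf]
  have hcs : Summable fun χ => ‖c χ‖ := summable_fourier_mul hν hμ _ _
  -- The trivial character in F gives ν(p) = δ; the tail δ/4 must stay below the threshold δ/2
  -- defining U.
  obtain ⟨F, hF1, hF⟩ : ∃ F : Finset (AddChar Γ Circle), 1 ∈ F ∧
      ∑' χ : {χ // χ ∉ F}, ‖c χ‖ < δ / 4 := by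
    have h1 := (tendsto_tsum_compl_atTop_zero fun χ => ‖c χ‖).eventually
      (gt_mem_nhds (show (0 : ℝ) < δ / 4 by positivity))
    obtain ⟨F, hF, hF'⟩ := (h1.and (eventually_ge_atTop {1})).exists
    exact ⟨F, hF' (Finset.mem_singleton_self _), hF⟩
  set p : LInfty Γ := ∑ χ ∈ F, c χ • charFun χ with hp
  have hpx : ∀ x, p x = ∑ χ ∈ F, c χ * (χ x : ℂ) := fun x => by
    rw [hp, lp.coeFn_sum, Finset.sum_apply]
    rfl
  have hνp : ν p = δ := by
    rw [hp, map_sum, Finset.sum_eq_single 1, map_smul, charFun_one, hν.1.map_one', smul_eq_mul,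
      mul_one, hc1]
    · intro χ _ hχ
      have := map_star_charFun_mul hν hχ.symm
      rw [charFun_one, star_one, one_mul] at this
      rw [map_smul, this, smul_zero]
    · exact fun h => absurd hF1 h
  obtain ⟨γ₀, hγ₀⟩ : ∃ γ₀, δ / 2 < (p γ₀).re := by
    by_contra! h
    have := hν.1.re_map_mono (f := p) (g := ((δ / 2 : ℝ) : ℂ) • 1) fun x => by
      simpa using h x
    rw [hνp, map_smul, hν.1.map_one', smul_eq_mul, mul_one, Complex.ofReal_re,
      Complex.ofReal_re] at this
    linarith
  refine ⟨{x | δ / 2 < (p x).re}, ⟨γ₀, ?_⟩, ?_⟩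
  · simp only [hpx] at hγ₀ ⊢
    exact isBohrNhdOf_trigPolynomial F c _ hγ₀
  set D : Set Γ := {x | δ / 2 < (p x).re} \ (A + B) with hD
  have hsum := hasSum_avg_correlation he hν hμ (indicator A) (indicator D) (indicator B)
  -- If b ∈ B and x ∈ D then x - b ∉ A, as D misses A + B.
  have hzero : (avg μ fun b => indicator B b *
      ν (star (indicator D) * translateBy b (indicator A))) = 0 := by
    rw [← avg_zero (m := μ)]
    congr 1
    ext b
    by_cases hb : b ∈ B
    · rw [show star (indicator D) * translateBy b (indicator A) = 0 from ?_, map_zero, mul_zero]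
      ext x
      by_cases hx : x ∈ D
      · have : x - b ∉ A := fun h => hx.2 ⟨x - b, h, b, hb, sub_add_cancel x b⟩
        simp [this]
      · simp [hx]
    · simp [hb]
  rw [hzero] at hsum
  simp only [← mul_assoc] at hsum
  set d : AddChar Γ Circle → ℂ := fun χ => ν (star (indicator D) * charFun χ) with hd
  change HasSum (fun χ => c χ * d χ) 0 at hsum
  have hdle : ∀ χ, ‖d χ‖ ≤ measureOf ν D := fun χ => hν.1.norm_map_le_re fun x => by
    by_cases hx : x ∈ D
    · simpa [hx] using (Circle.norm_coe _).le
    · simp [hx]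
  have hfin : ∑ χ ∈ F, c χ * d χ = ν (star (indicator D) * p) := by
    rw [hp, Finset.mul_sum, map_sum]
    exact Finset.sum_congr rfl fun χ _ => by rw [mul_smul_comm, map_smul, smul_eq_mul]
  have hge : δ / 2 * measureOf ν D ≤ (ν (star (indicator D) * p)).re := by
    have := hν.1.re_map_mono (f := ((δ / 2 : ℝ) : ℂ) • indicator D)
      (g := star (indicator D) * p) fun x => by
        by_cases hx : x ∈ D
        · simpa [hx] using hx.1.le
        · simp [hx]
    rwa [map_smul, smul_eq_mul, Complex.re_ofReal_mul] at this
  have htail : ‖∑' χ : {χ // χ ∉ F}, c χ * d χ‖ ≤ δ / 4 * measureOf ν D := by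
    have h1 : Summable fun χ : {χ // χ ∉ F} => ‖c χ‖ * measureOf ν D :=
      (hcs.subtype _).mul_right _
    refine (tsum_of_norm_bounded h1.hasSum fun χ => ?_).trans ?_
    · rw [norm_mul]
      exact mul_le_mul_of_nonneg_left (hdle χ) (norm_nonneg _)
    · rw [tsum_mul_right]
      exact mul_le_mul_of_nonneg_right hF.le (hν.1.measureOf_nonneg D)
  have hsplit := hsum.summable.sum_add_tsum_compl (s := F)
  rw [hsum.tsum_eq, hfin] at hsplit
  have hre := congrArg Complex.re hsplit
  rw [Complex.add_re, Complex.zero_re] at hre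
  have h2 := (abs_le.1 ((Complex.abs_re_le_norm _).trans htail)).1
  have h3 := hν.1.measureOf_nonneg D
  refine le_antisymm ?_ h3
  change measureOf ν D ≤ 0
  -- The expansion sums to 0, so (δ/2) ν(D) ≤ main term = -tail ≤ (δ/4) ν(D), forcing ν(D) = 0.
  have h4 : (∑' χ : {χ // χ ∉ F}, c χ * d χ).re = -(ν (star (indicator D) * p)).re := by
    linarith! [hre]
  rw [h4] at h2
  nlinarith

end BohrSets

end SumsetBohr

end

theorem corollary1p5 {Γ : Type*} [AddCommGroup Γ] (A B : Set Γ)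
    (hA : 0 < SumsetBohr.upperBanachDensity A) (hB : 0 < SumsetBohr.upperBanachDensity B) :
    SumsetBohr.IsPiecewiseBohr (A + B) ∧
    SumsetBohr.IsPiecewiseSyndetic (A + B) ∧
    ∀ ν ∈ SumsetBohr.extremeInvariantMeans Γ, 0 < SumsetBohr.measureOf ν A →
      ∃ U : Set Γ, SumsetBohr.IsBohrNhd U ∧ SumsetBohr.SubsetMod ν U (A + B) := by
  obtain ⟨m, hm, hmA⟩ := SumsetBohr.exists_measureOf_pos hA
  obtain ⟨μ, hμ, hμB⟩ := SumsetBohr.exists_measureOf_pos hB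
  obtain ⟨ν, hν, hle⟩ := SumsetBohr.exists_extreme_measureOf_ge hm A
  obtain ⟨U, hU, hsub⟩ :=
    SumsetBohr.exists_isBohrNhd_subsetMod_add hν hμ (hmA.trans_le hle) hμB
  exact ⟨⟨ν, hν.1, U, hU, hsub⟩, ⟨ν, hν.1, U, hU.isSyndetic, hsub⟩, fun ν' hν' hA' =>
    SumsetBohr.exists_isBohrNhd_subsetMod_add hν' hμ hA' hμB⟩
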